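/- Let $\gamma\in[0,1)$, $R_{\max}>0$ and let $K\ge 2$ be an integer. Consider the class $\mathcal M$ of all MDPs $M=(\mathcal X,\mathcal A,p,\gamma,\mathcal R)$ with finite state space $\mathcal X$, finite action space $\mathcal A$, transition probabilities $p(\cdot\mid x,a)$, discount factor $\gamma$, and immediate reward distributions $\mathcal R(x,a)$ supported on $[-R_{\max},R_{\max}]$. Given the current state-action pair, the immediate reward and the next state are independent. For a Markov policy $\pi:\mathcal X\to\mathscr P(\mathcal A)$ let $\eta_\pi(x,a)$ be the law of the return $\sum_{t\ge 0}\gamma^tR_t$ given $X_0=x$, $A_0=a$ when actions are selected by $\pi$. For $\eta\in\mathscr P(\mathbb R)^{\mathcal X\times\mathcal A}$ let $(\mathcal T^\pi\eta)(x,a)$ be the law of $R_0+\gamma Z$, where $R_0\sim\mathcal R(x,a)$ is independent of $(X_1,A_1,Z)$, $X_1\sim p(\cdot\mid x,a)$, $A_1\sim\pi(\cdot\mid X_1)$, and $Z\sim\eta(X_1,A_1)$ given $(X_1,A_1)$. Let $-R_{\max}/(1-\gamma)=z_1<\cdots<z_K=R_{\max}/(1-\gamma)$ be evenly spaced. The CDRL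 statistics are $$s_k(\mu)=\mathbb E_{Z\sim\mu}[h_k(Z)],\qquad k=1,\dots,K-1,$$ where $h_k$ equals $1$ on $(-\infty,z_k]$, equals $0$ on $[z_{k+1},\infty)$ and is linear on $[z_k,z_{k+1}]$. The CDRL imputation strategy $\Psi$ maps a vector $(\sigma_1,\dots,\sigma_{K-1})$ of values that these statistics take at some probability distribution to the distribution $\sum_{k=1}^Kp_k\delta_{z_k}$ with $p_1=\sigma_1$, $p_k=\sigma_k-\sigma_{k-1}$ for $2\le k\le K-1$, and $p_K=1-\sum_{k<K}p_k$; this is a probability distribution with statistics $\sigma_1,\dots,\sigma_{K-1}$. Then CDRL is $\varepsilon$-approximately Bellman closed for $\mathcal M$ with $$\varepsilon=\frac{\gamma}{2(1-\gamma)(K-1)}.$$ That is, for every $M\in\mathcal M$ and every policy $\pi$, the repeated updates $$\hat s_k(x,a)\leftarrow s_k\bigl((\mathcal T^\pi\eta)(x,a)\bigr)\quad\text{for all }x,a,k,\qquad \eta(x',a')=\Psi(\hat s_{1:K-1}(x',a')),$$ converge, from every initial collection of attainable statistic values, to one and the same fixed point $(\hat s_k(x,a))$ (the learnt values), and $$\sup_{(x,a)\in\mathcal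 X\times\mathcal A}\ \frac1{K-1}\sum_{k=1}^{K-1}\bigl|s_k(\eta_\pi(x,a))-\hat s_k(x,a)\bigr|\le\varepsilon .$$ -/

import Mathlib

open MeasureTheory ProbabilityTheory Filter Topology
open scoped ENNReal

universe u v

namespace DistRL

noncomputable section

/-! ### Markov decision processes, policies and return distributions -/

/-- A finite Markov decision process `(𝒳, 𝒜, p, γ, ℛ)` with discount rate `γ ∈ [0, 1)`. -/
structure MDP where
  State : Type u
  Action : Type v
  [fintypeState : Fintype State]
  [fintypeAction : Fintype Action]
  /-- `trans x a` is the law `p(· | x, a)` of the next state. -/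
  trans : State → Action → PMF State
  γ : ℝ
  γ_nonneg : 0 ≤ γ
  γ_lt_one : γ < 1
  /-- `reward x a` is the law of the immediate reward received in state `x` under action `a`. -/
  reward : State → Action → ProbabilityMeasure ℝ

attribute [instance] MDP.fintypeState MDP.fintypeAction

namespace MDP

instance (M : MDP.{u, v}) : MeasurableSpace M.State := ⊤
instance (M : MDP.{u, v}) : MeasurableSpace M.Action := ⊤
instance (M : MDP.{u, v}) : DiscreteMeasurableSpace M.State := ⟨fun _ => trivial⟩
instance (M : MDP.{u, v}) : DiscreteMeasurableSpace M.Action := ⟨fun _ => trivial⟩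

/-- A (stationary) Markov policy `π : 𝒳 → 𝒫(𝒜)`. -/
abbrev Policy (M : MDP.{u, v}) : Type (max u v) := M.State → PMF M.Action

/-- A state-action pair. -/
abbrev Pair (M : MDP.{u, v}) : Type (max u v) := M.State × M.Action

/-- What happens at one time step `t`: the pair `(X_t, A_t)` together with the reward `R_t`. -/
abbrev Step (M : MDP.{u, v}) : Type (max u v) := M.Pair × ℝ

/-- The law of `(X_{t+1}, A_{t+1})` given `(X_t, A_t) = y`:
`X_{t+1} ∼ p(· | y)` and then `A_{t+1} ∼ π(· | X_{t+1})`. -/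
def nextPair (M : MDP.{u, v}) (π : M.Policy) (y : M.Pair) : PMF M.Pair :=
  (M.trans y.1 y.2).bind fun x' => (π x').map fun a' => (x', a')

/-- The reward distributions, as a Markov kernel. -/
def rewardKernel (M : MDP.{u, v}) : Kernel M.Pair ℝ :=
  Kernel.ofFunOfCountable fun y => (M.reward y.1 y.2 : Measure ℝ)

instance (M : MDP.{u, v}) : IsMarkovKernel M.rewardKernel :=
  ⟨fun y => inferInstanceAs (IsProbabilityMeasure (M.reward y.1 y.2 : Measure ℝ))⟩

/-- The law of `((X, A), R)` when `(X, A) ∼ q` and `R ∼ ℛ(X, A)`. -/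
def stepLaw (M : MDP.{u, v}) (q : PMF M.Pair) : Measure M.Step :=
  q.toMeasure ⊗ₘ M.rewardKernel

instance (M : MDP.{u, v}) (q : PMF M.Pair) : IsProbabilityMeasure (M.stepLaw q) := by
  unfold stepLaw; infer_instance

/-- The one-step transition kernel of the Markov chain `t ↦ ((X_t, A_t), R_t)`. The next step
depends on `(X_t, A_t)` only; in particular, given `(X_t, A_t)` it is independent of `R_t`. -/
def stepKernel (M : MDP.{u, v}) (π : M.Policy) : Kernel M.Step M.Step :=
  (Kernel.ofFunOfCountable fun y => M.stepLaw (M.nextPair π y)).comap Prod.fst measurable_fst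

instance (M : MDP.{u, v}) (π : M.Policy) : IsMarkovKernel (M.stepKernel π) :=
  ⟨fun w => inferInstanceAs (IsProbabilityMeasure (M.stepLaw (M.nextPair π w.1)))⟩

/-- The transition kernels at each time, as functions of the whole past. -/
def historyKernel (M : MDP.{u, v}) (π : M.Policy) (n : ℕ) :
    Kernel ((i : Finset.Iic n) → (fun _ : ℕ => M.Step) i) M.Step :=
  (M.stepKernel π).comap (fun h => h ⟨n, Finset.mem_Iic.2 le_rfl⟩) (measurable_pi_apply _)

instance (M : MDP.{u, v}) (π : M.Policy) (n : ℕ) : IsMarkovKernel (M.historyKernel π n) := by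
  unfold historyKernel; infer_instance

/-- The law of the trajectory `(X_t, A_t, R_t)_{t ≥ 0}` given `X_0 = x`, `A_0 = a`, when actions
are selected according to `π`. -/
def trajLaw (M : MDP.{u, v}) (π : M.Policy) (x : M.State) (a : M.Action) :
    Measure (ℕ → M.Step) :=
  Kernel.trajMeasure (X := fun _ => M.Step) (M.stepLaw (PMF.pure (x, a))) (M.historyKernel π)

instance (M : MDP.{u, v}) (π : M.Policy) (x : M.State) (a : M.Action) :
    IsProbabilityMeasure (M.trajLaw π x a) := by
  unfold trajLaw; infer_instance

/-- The random return `∑ₜ γ ^ t R_t` along a trajectory. -/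
def discountedReturn (M : MDP.{u, v}) (ω : ℕ → M.Step) : ℝ :=
  ∑' t : ℕ, M.γ ^ t * (ω t).2

theorem measurable_discountedReturn (M : MDP.{u, v}) : Measurable M.discountedReturn :=
  Measurable.tsum fun t => by fun_prop

/-- The return distribution `η^π(x, a)`: the law of `∑ₜ γ ^ t R_t` given `X_0 = x`, `A_0 = a`. -/
def returnDist (M : MDP.{u, v}) (π : M.Policy) (x : M.State) (a : M.Action) :
    ProbabilityMeasure ℝ :=
  ⟨(M.trajLaw π x a).map M.discountedReturn,
    Measure.isProbabilityMeasure_map M.measurable_discountedReturn.aemeasurable⟩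

/-- The distributional Bellman operator. `(𝒯^π η)(x, a)` is the law of `R_0 + γ Z`, where
`R_0 ∼ ℛ(x, a)`, independently `X_1 ∼ p(· | x, a)`, `A_1 ∼ π(· | X_1)`, and, given these,
`Z ∼ η(X_1, A_1)`; that is, the mixture of the pushforwards of `η(X_1, A_1)` under
`z ↦ R_0 + γ z`. -/
def bellman (M : MDP.{u, v}) (π : M.Policy) (η : M.State → M.Action → ProbabilityMeasure ℝ)
    (x : M.State) (a : M.Action) : ProbabilityMeasure ℝ :=
  ⟨∑ y : M.Pair, M.nextPair π (x, a) y •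
      (((M.reward x a : Measure ℝ).prod (η y.1 y.2 : Measure ℝ)).map
        fun rz : ℝ × ℝ => rz.1 + M.γ * rz.2), by
    constructor
    have h : ∀ y : M.Pair, (((M.reward x a : Measure ℝ).prod (η y.1 y.2 : Measure ℝ)).map
        fun rz : ℝ × ℝ => rz.1 + M.γ * rz.2) Set.univ = 1 := fun y => by
      rw [Measure.map_apply (by fun_prop) MeasurableSet.univ]
      simp
    simp only [Measure.coe_finsetSum, Finset.sum_apply, Measure.smul_apply, h, smul_eq_mul,
      mul_one]
    rw [← tsum_fintype (L := SummationFilter.unconditional _)]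
    exact (M.nextPair π (x, a)).tsum_coe⟩

end MDP

/-! ### Statistics, imputation strategies and approximate Bellman closedness -/

/-- A statistic of probability distributions on the real line. -/
abbrev Statistic : Type := ProbabilityMeasure ℝ → ℝ

/-- The vectors of statistic values that some probability distribution has. -/
def attainable {N : ℕ} (s : Fin N → Statistic) : Set (Fin N → ℝ) :=
  Set.range fun μ : ProbabilityMeasure ℝ => fun k => s k μ

/-- An imputation strategy maps each (attainable) vector of statistic values to a probability
distribution that has those statistics. -/
structure ImputationStrategy {N : ℕ} (s : Fin N → Statistic) where
  impute : attainable s → ProbabilityMeasure ℝ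
  consistent : ∀ (σ : attainable s) (k : Fin N), s k (impute σ) = (σ : Fin N → ℝ) k

/-- Estimates of the values of the statistics at all state-action pairs. -/
abbrev Estimates (M : MDP.{u, v}) {N : ℕ} (s : Fin N → Statistic) : Type (max u v) :=
  M.State → M.Action → attainable s

/-- One dynamic programming update of the statistics: impute the distributions
`η(x', a') = Ψ(ŝ(x', a'))`, and replace `ŝ_k(x, a)` by `s_k((𝒯^π η)(x, a))`. -/
def update (M : MDP.{u, v}) (π : M.Policy) {N : ℕ} (s : Fin N → Statistic)
    (Ψ : ImputationStrategy s) (σ : Estimates M s) : Estimates M s :=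
  fun x a => ⟨fun k => s k (M.bellman π (fun x' a' => Ψ.impute (σ x' a')) x a),
    Set.mem_range_self _⟩

/-- `σ` is the collection of learnt values of the statistics: the fixed point of the update, to
which the repeated updates converge from every initial collection of estimates. -/
def IsLearnt (M : MDP.{u, v}) (π : M.Policy) {N : ℕ} (s : Fin N → Statistic)
    (Ψ : ImputationStrategy s) (σ : Estimates M s) : Prop :=
  update M π s Ψ σ = σ ∧
    ∀ σ₀ : Estimates M s, Tendsto (fun n : ℕ => (update M π s Ψ)^[n] σ₀) atTop (𝓝 σ)

/-- Learnt values are unique. -/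
theorem IsLearnt.unique {M : MDP.{u, v}} {π : M.Policy} {N : ℕ} {s : Fin N → Statistic}
    {Ψ : ImputationStrategy s} {σ τ : Estimates M s} (hσ : IsLearnt M π s Ψ σ)
    (hτ : IsLearnt M π s Ψ τ) : σ = τ :=
  tendsto_nhds_unique (hσ.2 σ) (hτ.2 σ)

/-- The statistics `s`, together with the imputation strategy `Ψ`, are `ε`-approximately Bellman
closed for the class `𝓜`: for every MDP in `𝓜` and every policy, the learnt values exist, and at
every state-action pair their average absolute error is at most `ε`. -/
def ApproxBellmanClosed (𝓜 : Set MDP.{u, v}) {N : ℕ} (s : Fin N → Statistic)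
    (Ψ : ImputationStrategy s) (ε : ℝ) : Prop :=
  ∀ M ∈ 𝓜, ∀ π : M.Policy, ∃ σ : Estimates M s, IsLearnt M π s Ψ σ ∧
    ∀ (x : M.State) (a : M.Action),
      (1 / (N : ℝ)) * ∑ k : Fin N, |s k (M.returnDist π x a) - (σ x a : Fin N → ℝ) k| ≤ ε

/-- The MDPs with discount rate `γ` and reward distributions supported on `[-Rmax, Rmax]`. -/
def boundedRewardMDPs (γ Rmax : ℝ) : Set MDP.{u, v} :=
  {M | M.γ = γ ∧
    ∀ x a, (M.reward x a : Measure ℝ) (Set.Icc (-Rmax) Rmax) = 1}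

/-! ### Categorical distributional reinforcement learning -/

/-- `h_{a,b}`: equal to `1` on `(-∞, a]`, to `0` on `[b, ∞)`, and linear on `[a, b]`. -/
def ramp (a b x : ℝ) : ℝ :=
  if x ≤ a then 1 else if b ≤ x then 0 else (b - x) / (b - a)

/-- The statistics `s_{z_k, z_{k+1}}(μ) = 𝔼_{Z ∼ μ}[h_{z_k, z_{k+1}}(Z)]` of CDRL with bin
locations `z_1 < ⋯ < z_K` (indexed from `0` here). There are `K - 1` of them. -/
def cdrlStat {K : ℕ} (z : Fin K → ℝ) (k : Fin (K - 1)) : Statistic := fun μ =>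
  ∫ x, ramp (z ⟨k, by omega⟩) (z ⟨k + 1, by omega⟩) x ∂(μ : Measure ℝ)

/-- The sums `p_1 + ⋯ + p_j` of the first `j` CDRL probabilities: `0` for `j = 0`, `σ_j` for
`1 ≤ j ≤ K - 1`, and `1` for `j = K`. -/
def cdrlCum {K : ℕ} (σ : Fin (K - 1) → ℝ) (j : ℕ) : ℝ :=
  if j = 0 then 0 else if h : j - 1 < K - 1 then σ ⟨j - 1, h⟩ else 1

/-- The CDRL probabilities: `p_1 = σ_1`, `p_k = σ_k - σ_{k-1}` for `2 ≤ k ≤ K - 1`, and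
`p_K = 1 - ∑_{k < K} p_k = 1 - σ_{K-1}` (indexed from `0` here). -/
def cdrlProb {K : ℕ} (σ : Fin (K - 1) → ℝ) (j : Fin K) : ℝ :=
  cdrlCum σ (j + 1) - cdrlCum σ j

/-- The distribution `∑ₖ pₖ δ_{zₖ}` imputed by CDRL. -/
def cdrlMeasure {K : ℕ} (z : Fin K → ℝ) (σ : Fin (K - 1) → ℝ) : Measure ℝ :=
  ∑ j : Fin K, ENNReal.ofReal (cdrlProb σ j) • Measure.dirac (z j)

theorem ramp_nonneg (a b x : ℝ) : 0 ≤ ramp a b x := by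
  unfold ramp
  split_ifs with h1 h2
  · exact zero_le_one
  · exact le_rfl
  · push Not at h2
    exact div_nonneg (by linarith) (by linarith)

theorem ramp_le_one (a b x : ℝ) : ramp a b x ≤ 1 := by
  unfold ramp
  split_ifs with h1 h2
  · exact le_rfl
  · exact zero_le_one
  · push Not at h1
    rw [div_le_one (by linarith)]
    linarith

theorem ramp_le_ramp {a b c d : ℝ} (hab : a < b) (hbc : b ≤ c) (x : ℝ) :
    ramp a b x ≤ ramp c d x := by
  rcases le_total x c with h | h
  · calc ramp a b x ≤ 1 := ramp_le_one a b x
      _ = ramp c d x := by simp [ramp, h]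
  · have hx : ramp a b x = 0 := by
      have h1 : ¬ x ≤ a := by push Not; linarith
      have h2 : b ≤ x := hbc.trans h
      simp [ramp, h1, h2]
    rw [hx]
    exact ramp_nonneg c d x

theorem measurable_ramp (a b : ℝ) : Measurable (ramp a b) := by
  unfold ramp
  refine Measurable.ite measurableSet_Iic measurable_const ?_
  exact Measurable.ite measurableSet_Ici measurable_const (by fun_prop)

theorem integrable_ramp (a b : ℝ) (μ : ProbabilityMeasure ℝ) :
    Integrable (ramp a b) (μ : Measure ℝ) :=
  Integrable.of_bound (measurable_ramp a b).aestronglyMeasurable 1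
    (ae_of_all _ fun x => by
      rw [Real.norm_of_nonneg (ramp_nonneg a b x)]
      exact ramp_le_one a b x)

theorem cdrlProb_nonneg {K : ℕ} {z : Fin K → ℝ} (hz : StrictMono z)
    (σ : attainable (cdrlStat z)) (j : Fin K) : 0 ≤ cdrlProb (σ : Fin (K - 1) → ℝ) j := by
  obtain ⟨_, μ, rfl⟩ := σ
  have hlt : ∀ (i : ℕ) (hi : i < K - 1),
      z ⟨i, by omega⟩ < z ⟨i + 1, by omega⟩ := fun i hi => hz (by simp)
  unfold cdrlProb cdrlCum
  simp only [Nat.succ_ne_zero, if_false, add_tsub_cancel_right, sub_nonneg]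
  rcases Nat.eq_zero_or_pos (j : ℕ) with h0 | h0
  · rw [if_pos h0]
    split_ifs with h1
    · exact integral_nonneg fun x => ramp_nonneg _ _ x
    · exact zero_le_one
  · rw [if_neg (by omega)]
    have hj := j.2
    have h2 : (j : ℕ) - 1 < K - 1 := by omega
    rw [dif_pos h2]
    split_ifs with h1
    · refine integral_mono (integrable_ramp _ _ μ) (integrable_ramp _ _ μ)
        fun x => ramp_le_ramp (hlt _ h2) (hz.monotone ?_) x
      simp only [Fin.mk_le_mk]
      omega
    · calc cdrlStat z ⟨(j : ℕ) - 1, h2⟩ μ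
          ≤ ∫ _, (1 : ℝ) ∂(μ : Measure ℝ) :=
            integral_mono (integrable_ramp _ _ μ) (integrable_const _)
              fun x => ramp_le_one _ _ x
        _ = 1 := by simp

theorem sum_cdrlProb {K : ℕ} (σ : Fin (K - 1) → ℝ) (f : ℕ → ℝ) :
    ∑ j : Fin K, cdrlProb σ j * f j
      = ∑ j ∈ Finset.range K, (cdrlCum σ (j + 1) - cdrlCum σ j) * f j := by
  rw [Finset.sum_range]
  rfl

theorem isProbabilityMeasure_cdrlMeasure {K : ℕ} (hK : 2 ≤ K) {z : Fin K → ℝ}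
    (hz : StrictMono z) (σ : attainable (cdrlStat z)) :
    IsProbabilityMeasure (cdrlMeasure z (σ : Fin (K - 1) → ℝ)) := by
  constructor
  simp only [cdrlMeasure, Measure.coe_finsetSum, Finset.sum_apply, Measure.smul_apply,
    measure_univ, smul_eq_mul, mul_one]
  rw [← ENNReal.ofReal_sum_of_nonneg fun j _ => cdrlProb_nonneg hz σ j]
  have h := sum_cdrlProb (σ : Fin (K - 1) → ℝ) fun _ => 1
  simp only [mul_one] at h
  rw [h, Finset.sum_range_sub]
  have h1 : ¬ K = 0 := by omega
  simp [cdrlCum, h1]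

theorem cdrlStat_cdrlMeasure {K : ℕ} (hK : 2 ≤ K) {z : Fin K → ℝ} (hz : StrictMono z)
    (σ : attainable (cdrlStat z)) (k : Fin (K - 1)) :
    cdrlStat z k ⟨cdrlMeasure z (σ : Fin (K - 1) → ℝ),
      isProbabilityMeasure_cdrlMeasure hK hz σ⟩ = (σ : Fin (K - 1) → ℝ) k := by
  have hk := k.2
  have hval : ∀ j : Fin K, ramp (z ⟨k, by omega⟩) (z ⟨k + 1, by omega⟩) (z j)
      = if (j : ℕ) < k + 1 then 1 else 0 := fun j => by
    unfold ramp
    by_cases hj : (j : ℕ) < k + 1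
    · rw [if_pos (hz.monotone (by rw [Fin.le_def]; simp; omega)), if_pos hj]
    · rw [if_neg (not_le.2 (hz (by rw [Fin.lt_def]; simp; omega))),
        if_pos (hz.monotone (by rw [Fin.le_def]; simp; omega)), if_neg hj]
  simp only [cdrlStat, ProbabilityMeasure.coe_mk, cdrlMeasure]
  rw [integral_finsetSum_measure fun j _ =>
    (integrable_dirac (by simp [enorm_lt_top])).smul_measure ENNReal.ofReal_ne_top]
  simp only [integral_smul_measure, integral_dirac, hval,
    ENNReal.toReal_ofReal (cdrlProb_nonneg hz σ _), smul_eq_mul]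
  rw [sum_cdrlProb (σ : Fin (K - 1) → ℝ) fun j => if j < k + 1 then 1 else 0]
  simp only [mul_ite, mul_one, mul_zero]
  rw [← Finset.sum_filter]
  have hfil : (Finset.range K).filter (fun j => j < (k : ℕ) + 1) = Finset.range (k + 1) := by
    ext j
    simp only [Finset.mem_filter, Finset.mem_range]
    omega
  rw [hfil, Finset.sum_range_sub]
  simp [cdrlCum]

/-- The imputation strategy of CDRL. -/
def cdrlImputation {K : ℕ} (hK : 2 ≤ K) (z : Fin K → ℝ) (hz : StrictMono z) :
    ImputationStrategy (cdrlStat z) where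
  impute σ := ⟨cdrlMeasure z (σ : Fin (K - 1) → ℝ), isProbabilityMeasure_cdrlMeasure hK hz σ⟩
  consistent σ k := cdrlStat_cdrlMeasure hK hz σ k

end

end DistRL

/-!
Let `Δ` be the grid step. On the grid, the `ℓ¹` distance between the statistics of two distributions
is `1 / Δ` times the `1`-Wasserstein distance between the imputed distributions. It is handled
through its dual, signed sums of ramps, which are `1 / Δ`-Lipschitz functions
(`sum_abs_gridRamp_sub_le`). Integrating such a function against `𝒯^π η` amounts to averaging
integrals of `γ / Δ`-Lipschitz functions against the `η(x', a')`, so it suffices to compare the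
latter (`sum_abs_cdrlStat_bellman_sub_le`).

* Between two imputed distributions, the integrals of a `γ / Δ`-Lipschitz function differ by at most
  `γ` times the `ℓ¹` distance of the statistics. Hence the update is a `γ`-contraction
  (`sum_abs_update_sub_le`). The attainable vectors form a closed set, so the updates converge to a
  unique fixed point (`exists_isLearnt`).
* For a distribution `μ` on `[z_1, z_K]`, integrating `g` against the distribution imputed from `μ`
  is the same as integrating the piecewise linear interpolation of `g` against `μ`. For a
  `γ / Δ`-Lipschitz `g` this costs at most `γ / 2` (`abs_sub_gridInterp_le`).

The return distributions satisfy `η^π = 𝒯^π η^π` (`MDP.bellman_returnDist`) and live on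
`[z_1, z_K]`, so the largest `ℓ¹` error `D` of the learnt values satisfies `D ≤ γ / 2 + γ D`, that
is, `D ≤ γ / (2 (1 - γ))` (`sum_abs_returnDist_sub_le`). Dividing by `K - 1` gives the theorem.

The Bellman equation is read off from a first-step decomposition of the trajectory law
(`MDP.trajLaw_eq_restartLaw`): the law obtained by prepending one step to a fresh trajectory has the
same initial law and transition kernels as the trajectory law, and these determine it
(`ext_of_transition`).
-/

namespace DistRL

/-! ### Ramps and piecewise linear interpolation on an evenly spaced grid -/

/-- Up to the factor `b - a`, the ramp is the length of the part of `[a, b]` to the right of `x`. -/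
theorem ramp_mul_sub {a b : ℝ} (hab : a < b) (x : ℝ) :
    ramp a b x * (b - a) = max x b - max x a := by
  unfold ramp
  split_ifs with h1 h2
  · rw [max_eq_right h1, max_eq_right (h1.trans hab.le), one_mul]
  · rw [max_eq_left h2, max_eq_left (hab.le.trans h2), zero_mul, sub_self]
  · push Not at h1 h2
    rw [max_eq_right h2.le, max_eq_left h1.le, div_mul_cancel₀ _ (by linarith)]

theorem ramp_antitone {a b : ℝ} (hab : a < b) : Antitone (ramp a b) := fun x y hxy => by
  have hx := ramp_mul_sub hab x
  have hy := ramp_mul_sub hab y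
  have h : max y b - max y a ≤ max x b - max x a := by
    rcases max_cases y b with h1 | h1 <;> rcases max_cases y a with h2 | h2 <;>
    rcases max_cases x b with h3 | h3 <;> rcases max_cases x a with h4 | h4 <;> linarith
  rw [← hx, ← hy] at h
  exact le_of_mul_le_mul_right h (by linarith)

/-- The `j`-th point of the evenly spaced grid with first point `c` and step `Δ`. -/
noncomputable def gridPoint (c Δ : ℝ) (j : ℕ) : ℝ := c + j * Δ

theorem gridPoint_succ (c Δ : ℝ) (j : ℕ) : gridPoint c Δ (j + 1) = gridPoint c Δ j + Δ := by
  unfold gridPoint; push_cast; ring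

theorem gridPoint_mono (c : ℝ) {Δ : ℝ} (hΔ : 0 < Δ) : Monotone (gridPoint c Δ) :=
  monotone_nat_of_le_succ fun j => by rw [gridPoint_succ]; linarith

/-- The `j`-th CDRL ramp of the grid: it descends from `1` to `0` on the cell
`[gridPoint j, gridPoint (j + 1)]`. -/
noncomputable def gridRamp (c Δ : ℝ) (j : ℕ) : ℝ → ℝ :=
  ramp (gridPoint c Δ j) (gridPoint c Δ (j + 1))

theorem gridPoint_lt_succ (c : ℝ) {Δ : ℝ} (hΔ : 0 < Δ) (j : ℕ) :
    gridPoint c Δ j < gridPoint c Δ (j + 1) := by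
  rw [gridPoint_succ]; linarith

/-- Each ramp is `1 / Δ` times the part of `(x, ∞)` lying in its cell, so the increments of the
ramps telescope and their absolute values add up to at most `|x - y| / Δ`. -/
theorem sum_abs_gridRamp_sub_le (c : ℝ) {Δ : ℝ} (hΔ : 0 < Δ) (n : ℕ) (x y : ℝ) :
    ∑ k ∈ Finset.range n, |gridRamp c Δ k x - gridRamp c Δ k y| ≤ |x - y| / Δ := by
  wlog hxy : x ≤ y generalizing x y
  · simpa only [abs_sub_comm] using this y x (le_of_not_ge hxy)
  have hsum : ∀ w, (∑ k ∈ Finset.range n, gridRamp c Δ k w) * Δ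
      = max w (gridPoint c Δ n) - max w (gridPoint c Δ 0) := fun w => by
    rw [Finset.sum_mul, ← Finset.sum_range_sub fun k => max w (gridPoint c Δ k)]
    refine Finset.sum_congr rfl fun k _ => ?_
    rw [← ramp_mul_sub (gridPoint_lt_succ c hΔ k), gridPoint_succ, add_sub_cancel_left, gridRamp,
      gridPoint_succ]
  have habs : ∀ k, |gridRamp c Δ k x - gridRamp c Δ k y|
      = gridRamp c Δ k x - gridRamp c Δ k y := fun k =>
    abs_of_nonneg (sub_nonneg.2 (ramp_antitone (gridPoint_lt_succ c hΔ k) hxy))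
  simp only [habs]
  rw [Finset.sum_sub_distrib, le_div_iff₀ hΔ, sub_mul, hsum, hsum, abs_sub_comm,
    abs_of_nonneg (sub_nonneg.2 hxy)]
  have hmono := gridPoint_mono c hΔ n.zero_le
  rcases max_cases y (gridPoint c Δ n) with h1 | h1 <;>
  rcases max_cases y (gridPoint c Δ 0) with h2 | h2 <;>
  rcases max_cases x (gridPoint c Δ n) with h3 | h3 <;>
  rcases max_cases x (gridPoint c Δ 0) with h4 | h4 <;> linarith

/-- The piecewise linear interpolation of `g` at the first `n + 1` grid points, extended by
constants outside the grid. -/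
noncomputable def gridInterp (c Δ : ℝ) (n : ℕ) (g : ℝ → ℝ) (x : ℝ) : ℝ :=
  g (gridPoint c Δ n) + ∑ k ∈ Finset.range n,
    gridRamp c Δ k x * (g (gridPoint c Δ k) - g (gridPoint c Δ (k + 1)))

theorem gridInterp_succ_of_le {c Δ : ℝ} (n : ℕ) (g : ℝ → ℝ) {x : ℝ}
    (hx : x ≤ gridPoint c Δ n) : gridInterp c Δ (n + 1) g x = gridInterp c Δ n g x := by
  have h : gridRamp c Δ n x = 1 := by simp [gridRamp, ramp, hx]
  rw [gridInterp, Finset.sum_range_succ, h, gridInterp]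
  ring

theorem gridInterp_succ_of_ge {c Δ : ℝ} (hΔ : 0 < Δ) (n : ℕ) (g : ℝ → ℝ) {x : ℝ}
    (hx : gridPoint c Δ n ≤ x) : gridInterp c Δ (n + 1) g x = g (gridPoint c Δ (n + 1))
      + gridRamp c Δ n x * (g (gridPoint c Δ n) - g (gridPoint c Δ (n + 1))) := by
  rw [gridInterp, Finset.sum_range_succ, Finset.sum_eq_zero, zero_add]
  intro k hk
  have h0 : gridPoint c Δ (k + 1) ≤ x :=
    (gridPoint_mono c hΔ (Finset.mem_range.1 hk)).trans hx
  have h1 := gridPoint_lt_succ c hΔ k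
  have h : gridRamp c Δ k x = 0 := by
    rw [gridRamp, ramp, if_neg (by linarith), if_pos h0]
  rw [h, zero_mul]

/-- The linear interpolation of an `L`-Lipschitz function on a cell of length `Δ` has error at
most `2 t (1 - t) L Δ ≤ L Δ / 2` at the point dividing the cell in the ratio `t : 1 - t`. -/
theorem abs_sub_gridInterp_le {c Δ L : ℝ} (hΔ : 0 < Δ) {g : ℝ → ℝ}
    (hg : ∀ x y, |g x - g y| ≤ L * |x - y|) (n : ℕ) {x : ℝ} (hx0 : gridPoint c Δ 0 ≤ x)
    (hxn : x ≤ gridPoint c Δ n) : |g x - gridInterp c Δ n g x| ≤ L * Δ / 2 := by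
  have hL : 0 ≤ L := by simpa using (abs_nonneg _).trans (hg 1 0)
  induction n with
  | zero =>
    have : x = gridPoint c Δ 0 := le_antisymm hxn hx0
    subst this
    simp only [gridInterp, Finset.range_zero, Finset.sum_empty, add_zero, sub_self, abs_zero]
    positivity
  | succ n ih =>
    rcases le_total x (gridPoint c Δ n) with h | h
    · rw [gridInterp_succ_of_le n g h]
      exact ih h
    rw [gridInterp_succ_of_ge hΔ n g h]
    have ht := ramp_mul_sub (gridPoint_lt_succ c hΔ n) x
    have ht0 := ramp_nonneg (gridPoint c Δ n) (gridPoint c Δ (n + 1)) x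
    have ht1 := ramp_le_one (gridPoint c Δ n) (gridPoint c Δ (n + 1)) x
    rw [max_eq_right hxn, max_eq_left h] at ht
    change gridRamp c Δ n x * _ = _ at ht
    change 0 ≤ gridRamp c Δ n x at ht0
    change gridRamp c Δ n x ≤ 1 at ht1
    generalize gridRamp c Δ n x = t at ht ht0 ht1 ⊢
    have hstep := gridPoint_succ c Δ n
    have ha := hg x (gridPoint c Δ n)
    have hb := hg x (gridPoint c Δ (n + 1))
    rw [abs_of_nonneg (by linarith : 0 ≤ x - gridPoint c Δ n)] at ha
    rw [abs_of_nonpos (by linarith : x - gridPoint c Δ (n + 1) ≤ 0)] at hb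
    have hxa : x - gridPoint c Δ n = (1 - t) * Δ := by
      rw [hstep] at ht; linear_combination ht
    have hxb : -(x - gridPoint c Δ (n + 1)) = t * Δ := by
      rw [hstep] at ht ⊢; linear_combination -ht
    rw [hxa] at ha
    rw [hxb] at hb
    generalize g (gridPoint c Δ n) = A at ha ⊢
    generalize g (gridPoint c Δ (n + 1)) = B at hb ⊢
    calc |g x - (B + t * (A - B))| = |t * (g x - A) + (1 - t) * (g x - B)| := by
          congr 1; ring
      _ ≤ t * |g x - A| + (1 - t) * |g x - B| := by
          refine (abs_add_le _ _).trans_eq ?_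
          rw [abs_mul, abs_mul, abs_of_nonneg ht0, abs_of_nonneg (by linarith : 0 ≤ 1 - t)]
      _ ≤ t * (L * ((1 - t) * Δ)) + (1 - t) * (L * (t * Δ)) := by
          have : 0 ≤ 1 - t := by linarith
          gcongr
      _ ≤ L * Δ / 2 := by
          have := mul_nonneg (mul_nonneg hL hΔ.le) (sq_nonneg (1 - 2 * t))
          linarith

/-! ### First-step decomposition of the trajectory law -/

/-- Two probability measures on trajectories agree as soon as they have the same law at time `0` and
the same transition kernels. -/
theorem ext_of_transition {X : ℕ → Type*} [∀ n, MeasurableSpace (X n)]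
    (κ : (n : ℕ) → Kernel ((i : Finset.Iic n) → X i) (X (n + 1))) [∀ n, IsMarkovKernel (κ n)]
    {P Q : Measure ((n : ℕ) → X n)} [IsProbabilityMeasure P] [IsProbabilityMeasure Q]
    (h0 : P.map (fun ω => ω 0) = Q.map (fun ω => ω 0))
    (hP : ∀ n, P.map (Preorder.frestrictLe n) ⊗ₘ κ n
      = P.map fun ω => (Preorder.frestrictLe n ω, ω (n + 1)))
    (hQ : ∀ n, Q.map (Preorder.frestrictLe n) ⊗ₘ κ n
      = Q.map fun ω => (Preorder.frestrictLe n ω, ω (n + 1))) : P = Q := by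
  have hfin : ∀ n, P.map (Preorder.frestrictLe n) = Q.map (Preorder.frestrictLe n) := by
    intro n
    induction n with
    | zero =>
      have hm : Measurable fun (w : X 0) (i : Finset.Iic 0) =>
          (Nat.le_zero.1 (Finset.mem_Iic.1 i.2) ▸ w : X i) := by
        refine measurable_pi_lambda _ fun i => ?_
        obtain ⟨i, hi⟩ := i
        obtain rfl := Nat.le_zero.1 (Finset.mem_Iic.1 hi)
        exact measurable_id
      have hc : (Preorder.frestrictLe 0 : ((n : ℕ) → X n) → _) =
          (fun (w : X 0) (i : Finset.Iic 0) =>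
            (Nat.le_zero.1 (Finset.mem_Iic.1 i.2) ▸ w : X i)) ∘ fun ω => ω 0 := by
        funext ω i
        obtain ⟨i, hi⟩ := i
        obtain rfl := Nat.le_zero.1 (Finset.mem_Iic.1 hi)
        rfl
      rw [hc, ← Measure.map_map hm (measurable_pi_apply 0), h0,
        Measure.map_map hm (measurable_pi_apply 0)]
    | succ n ih =>
      have h := hP n
      rw [ih, hQ n] at h
      -- `e` appends the point at time `n + 1` to a trajectory up to time `n`.
      let e : ((i : Finset.Iic n) → X i) × X (n + 1) → (i : Finset.Iic (n + 1)) → X i :=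
        fun p i => if hi : (i : ℕ) ≤ n then p.1 ⟨i, Finset.mem_Iic.2 hi⟩ else
          ((le_antisymm (Finset.mem_Iic.1 i.2) (not_le.1 hi) : (i : ℕ) = n + 1).symm ▸ p.2)
      have he : Measurable e := by
        refine measurable_pi_lambda _ fun i => ?_
        obtain ⟨i, hi⟩ := i
        by_cases hin : i ≤ n
        · simp only [e, hin, dite_true]
          fun_prop
        · obtain rfl : i = n + 1 := le_antisymm (Finset.mem_Iic.1 hi) (not_le.1 hin)
          simp only [e, hin, dite_false]
          exact measurable_snd
      have hc : (Preorder.frestrictLe (n + 1) : ((n : ℕ) → X n) → _) =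
          e ∘ fun ω => (Preorder.frestrictLe n ω, ω (n + 1)) := by
        funext ω i
        obtain ⟨i, hi⟩ := i
        by_cases hin : i ≤ n
        · simp [e, hin]
        · obtain rfl : i = n + 1 := le_antisymm (Finset.mem_Iic.1 hi) (not_le.1 hin)
          simp [e]
      have hmeas : Measurable fun ω : (n : ℕ) → X n =>
          (Preorder.frestrictLe n ω, ω (n + 1)) := by fun_prop
      rw [hc, ← Measure.map_map he hmeas, ← h, Measure.map_map he hmeas]
  have hid : Measurable fun ω : (n : ℕ) → X n => ω := measurable_id
  have hproj : IsProjectiveMeasureFamily fun I : Finset ℕ => Q.map I.restrict :=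
    isProjectiveMeasureFamily_map_restrict (X := fun n ω => ω n) (P := Q)
      fun n => (measurable_pi_apply n).aemeasurable
  have : ∀ I : Finset ℕ, IsProbabilityMeasure (Q.map I.restrict) := fun I =>
    Measure.isProbabilityMeasure_map (by fun_prop)
  refine IsProjectiveLimit.unique (P := fun I : Finset ℕ => Q.map I.restrict) ?_ fun I => rfl
  exact (isProjectiveLimit_nat_iff hproj P).2 hfin

theorem map_zero_trajMeasure {X : ℕ → Type*} [∀ n, MeasurableSpace (X n)]
    (μ : Measure (X 0)) [IsProbabilityMeasure μ]
    (κ : (n : ℕ) → Kernel ((i : Finset.Iic n) → X i) (X (n + 1))) [∀ n, IsMarkovKernel (κ n)] :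
    (Kernel.trajMeasure μ κ).map (fun ω => ω 0) = μ := by
  have hc : (fun ω : (n : ℕ) → X n => ω 0) =
      (fun h : (i : Finset.Iic 0) → X i => h ⟨0, Finset.mem_Iic.2 le_rfl⟩)
        ∘ Preorder.frestrictLe 0 := rfl
  rw [hc, ← Measure.map_map (by fun_prop) (by fun_prop), Kernel.trajMeasure,
    Measure.map_comp _ _ (by fun_prop), Kernel.traj_map_frestrictLe, Kernel.partialTraj_self,
    Measure.id_comp]
  refine (Measure.map_map (measurable_pi_apply _)
    (MeasurableEquiv.piUnique fun i : Finset.Iic 0 => X i).symm.measurable).trans ?_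
  exact Measure.map_id

namespace MDP

variable {M : MDP.{u, v}} {π : M.Policy}

/-- The Markov property of the trajectory, tested against nonnegative functions of the steps up to
time `n + 1`. -/
theorem lintegral_trajLaw_succ (y : M.Pair) (n : ℕ)
    {f : ((Finset.Iic n) → M.Step) × M.Step → ℝ≥0∞} (hf : Measurable f) :
    ∫⁻ ω, f (Preorder.frestrictLe n ω, ω (n + 1)) ∂M.trajLaw π y.1 y.2
      = ∫⁻ ω, ∫⁻ w, f (Preorder.frestrictLe n ω, w) ∂M.stepKernel π (ω n)
          ∂M.trajLaw π y.1 y.2 := by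
  have h := Kernel.map_frestrictLe_trajMeasure_compProd_eq_map_trajMeasure
    (X := fun _ => M.Step) (μ₀ := M.stepLaw (PMF.pure y)) (κ := M.historyKernel π) (a := n)
  have h1 := congrArg (fun m => ∫⁻ p, f p ∂m) h
  rw [lintegral_map hf (by fun_prop), Measure.lintegral_compProd hf,
    lintegral_map (hf.lintegral_kernel_prod_right') (by fun_prop)] at h1
  exact h1.symm

theorem lintegral_stepLaw (q : PMF M.Pair) {f : M.Step → ℝ≥0∞} (hf : Measurable f) :
    ∫⁻ w, f w ∂M.stepLaw q = ∑ y, q y * ∫⁻ r, f (y, r) ∂(M.reward y.1 y.2 : Measure ℝ) := by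
  rw [stepLaw, Measure.lintegral_compProd hf, lintegral_fintype]
  refine Finset.sum_congr rfl fun y _ => ?_
  rw [PMF.toMeasure_apply_singleton _ _ (measurableSet_singleton y), mul_comm]
  rfl

theorem lintegral_stepKernel (w : M.Step) {f : M.Step → ℝ≥0∞} (hf : Measurable f) :
    ∫⁻ w', f w' ∂M.stepKernel π w =
      ∑ y, M.nextPair π w.1 y * ∫⁻ w', f w' ∂M.stepLaw (PMF.pure y) := by
  have h : M.stepKernel π w = M.stepLaw (M.nextPair π w.1) := rfl
  rw [h, lintegral_stepLaw _ hf]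
  refine Finset.sum_congr rfl fun y _ => ?_
  rw [lintegral_stepLaw _ hf, Finset.sum_eq_single y]
  · simp
  · intro b _ hb
    simp [PMF.pure_apply, hb]
  · simp

/-- The trajectory whose first step is `w` and which continues along `ω`. -/
def prepend (w : M.Step) (ω : ℕ → M.Step) : ℕ → M.Step
  | 0 => w
  | n + 1 => ω n

theorem measurable_prepend : Measurable fun p : M.Step × (ℕ → M.Step) => prepend p.1 p.2 := by
  refine measurable_pi_lambda _ fun n => ?_
  cases n with
  | zero => exact measurable_fst
  | succ n => exact (measurable_pi_apply n).comp measurable_snd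

theorem measurable_prepend_pair (y : M.Pair) :
    Measurable fun p : ℝ × (ℕ → M.Step) => prepend (y, p.1) p.2 :=
  measurable_prepend.comp ((measurable_const.prodMk measurable_fst).prodMk measurable_snd)

/-- The law of a trajectory which starts with the pair `y` and a reward drawn from it, and then
continues, independently of that reward, as a fresh trajectory from the next pair. -/
noncomputable def restartLaw (M : MDP.{u, v}) (π : M.Policy) (y : M.Pair) : Measure (ℕ → M.Step) :=
  ∑ y', M.nextPair π y y' • (((M.reward y.1 y.2 : Measure ℝ).prod (M.trajLaw π y'.1 y'.2)).map
    fun p => prepend (y, p.1) p.2)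

theorem lintegral_restartLaw (y : M.Pair) {f : (ℕ → M.Step) → ℝ≥0∞} (hf : Measurable f) :
    ∫⁻ ω, f ω ∂M.restartLaw π y = ∑ y', M.nextPair π y y' *
      ∫⁻ r, ∫⁻ ω, f (prepend (y, r) ω) ∂M.trajLaw π y'.1 y'.2
        ∂(M.reward y.1 y.2 : Measure ℝ) := by
  rw [restartLaw, lintegral_finsetSum_measure]
  refine Finset.sum_congr rfl fun y' _ => ?_
  rw [lintegral_smul_measure, lintegral_map hf (measurable_prepend_pair y), smul_eq_mul,
    lintegral_prod (fun p : ℝ × (ℕ → M.Step) => f (prepend (y, p.1) p.2))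
      (hf.comp (measurable_prepend_pair y)).aemeasurable]

theorem sum_nextPair (π : M.Policy) (y : M.Pair) : ∑ y', M.nextPair π y y' = 1 := by
  rw [← tsum_fintype (L := SummationFilter.unconditional _)]
  exact (M.nextPair π y).tsum_coe

instance (y : M.Pair) : IsProbabilityMeasure (M.restartLaw π y) := by
  constructor
  rw [← lintegral_one, lintegral_restartLaw y measurable_const]
  simp [sum_nextPair]

/-- The Markov property of `restartLaw`. At time `0` the next step is the first step of the fresh
trajectory; at later times the property is inherited from the fresh trajectory. -/
theorem lintegral_restartLaw_succ (y : M.Pair) (n : ℕ)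
    {f : ((Finset.Iic n) → M.Step) × M.Step → ℝ≥0∞} (hf : Measurable f) :
    ∫⁻ ω, f (Preorder.frestrictLe n ω, ω (n + 1)) ∂M.restartLaw π y
      = ∫⁻ ω, ∫⁻ w, f (Preorder.frestrictLe n ω, w) ∂M.stepKernel π (ω n)
          ∂M.restartLaw π y := by
  have hm2 : Measurable fun ω : ℕ → M.Step =>
      ∫⁻ w, f (Preorder.frestrictLe n ω, w) ∂M.stepKernel π (ω n) := by
    have h := hf.lintegral_kernel_prod_right' (κ := M.historyKernel π n)
    have hκ : ∀ ω : ℕ → M.Step,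
        M.stepKernel π (ω n) = M.historyKernel π n (Preorder.frestrictLe n ω) := fun _ => rfl
    simp only [hκ]
    exact Measurable.comp (g := fun h => ∫⁻ w, f (h, w) ∂M.historyKernel π n h) h
      (Preorder.measurable_frestrictLe (X := fun _ => M.Step) n)
  have hm1 : Measurable fun ω : ℕ → M.Step => f (Preorder.frestrictLe n ω, ω (n + 1)) :=
    hf.comp (by fun_prop)
  rw [lintegral_restartLaw y hm1, lintegral_restartLaw y hm2]
  cases n with
  | zero =>
    -- `c r` is the trajectory up to time `0` that consists of the pair `y` and the reward `r`.
    let c : ℝ → (Finset.Iic 0) → M.Step := fun r _ => (y, r)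
    have hc : Measurable c := by fun_prop
    have hres : ∀ r (ω : ℕ → M.Step), Preorder.frestrictLe 0 (prepend (y, r) ω) = c r := by
      intro r ω
      funext ⟨i, hi⟩
      obtain rfl := Nat.le_zero.1 (Finset.mem_Iic.1 hi)
      rfl
    have hfr : ∀ r, Measurable fun w => f (c r, w) := fun r => hf.comp (by fun_prop)
    have hl : ∀ (y' : M.Pair) r, ∫⁻ ω, f (Preorder.frestrictLe 0 (prepend (y, r) ω), ω 0)
        ∂M.trajLaw π y'.1 y'.2 = ∫⁻ w, f (c r, w) ∂M.stepLaw (PMF.pure y') := by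
      intro y' r
      have h0 := map_zero_trajMeasure (X := fun _ => M.Step) (M.stepLaw (PMF.pure y'))
        (M.historyKernel π)
      rw [← h0, lintegral_map (hfr r) (measurable_pi_apply 0)]
      simp only [hres]
      rfl
    have hr : ∀ (y' : M.Pair) r, ∫⁻ ω, ∫⁻ w, f (Preorder.frestrictLe 0 (prepend (y, r) ω), w)
        ∂M.stepKernel π (y, r) ∂M.trajLaw π y'.1 y'.2
          = ∫⁻ w, f (c r, w) ∂M.stepKernel π (y, r) := by
      intro y' r
      simp only [hres, lintegral_const, measure_univ, mul_one]
    change ∑ y', M.nextPair π y y' * ∫⁻ r, ∫⁻ ω,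
        f (Preorder.frestrictLe 0 (prepend (y, r) ω), ω 0) ∂M.trajLaw π y'.1 y'.2
          ∂(M.reward y.1 y.2 : Measure ℝ)
      = ∑ y', M.nextPair π y y' * ∫⁻ r, ∫⁻ ω, ∫⁻ w,
        f (Preorder.frestrictLe 0 (prepend (y, r) ω), w)
          ∂M.stepKernel π (y, r) ∂M.trajLaw π y'.1 y'.2 ∂(M.reward y.1 y.2 : Measure ℝ)
    simp only [hl, hr]
    rw [← Finset.sum_mul, sum_nextPair, one_mul]
    simp only [lintegral_stepKernel _ (hfr _)]
    have hmeas : ∀ y' : M.Pair, Measurable fun r => ∫⁻ w, f (c r, w) ∂M.stepLaw (PMF.pure y') :=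
      fun y' => Measurable.lintegral_prod_right' (f := fun p : ℝ × M.Step => f (c p.1, p.2))
        (hf.comp (by fun_prop))
    rw [lintegral_finsetSum _ fun y' _ => (hmeas y').const_mul _]
    refine Finset.sum_congr rfl fun y' _ => ?_
    rw [lintegral_const_mul _ (hmeas y')]
  | succ n =>
    refine Finset.sum_congr rfl fun y' _ => ?_
    congr 1
    refine lintegral_congr fun r => ?_
    -- `c` prepends the step `(y, r)` to a trajectory up to time `n`.
    let c : (Finset.Iic n → M.Step) → Finset.Iic (n + 1) → M.Step := fun h i =>
      if hi : (i : ℕ) = 0 then (y, r) else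
        h ⟨i - 1, Finset.mem_Iic.2 (by have := Finset.mem_Iic.1 i.2; omega)⟩
    have hc : Measurable c := by
      refine measurable_pi_lambda _ fun i => ?_
      by_cases hi : (i : ℕ) = 0
      · simp only [c, hi, dite_true]
        exact measurable_const
      · simp only [c, hi, dite_false]
        exact measurable_pi_apply _
    have hres : ∀ ω : ℕ → M.Step,
        Preorder.frestrictLe (n + 1) (prepend (y, r) ω) = c (Preorder.frestrictLe n ω) := by
      intro ω
      funext ⟨i, hi⟩
      cases i <;> rfl
    have h := lintegral_trajLaw_succ (π := π) y' n
      (f := fun p => f (c p.1, p.2)) (hf.comp (by fun_prop))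
    change ∫⁻ ω, f (Preorder.frestrictLe (n + 1) (prepend (y, r) ω), ω (n + 1))
        ∂M.trajLaw π y'.1 y'.2
      = ∫⁻ ω, ∫⁻ w, f (Preorder.frestrictLe (n + 1) (prepend (y, r) ω), w)
          ∂M.stepKernel π (ω n) ∂M.trajLaw π y'.1 y'.2
    simp only [hres]
    exact h

/-- First-step decomposition of the trajectory law. -/
theorem trajLaw_eq_restartLaw (y : M.Pair) : M.trajLaw π y.1 y.2 = M.restartLaw π y := by
  refine ext_of_transition (X := fun _ => M.Step) (M.historyKernel π) ?_
    (fun n => Kernel.map_frestrictLe_trajMeasure_compProd_eq_map_trajMeasure) fun n => ?_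
  · rw [trajLaw, map_zero_trajMeasure (X := fun _ => M.Step)]
    refine Measure.ext_of_lintegral _ fun f hf => ?_
    rw [lintegral_map hf (measurable_pi_apply 0),
      lintegral_restartLaw (f := fun ω => f (ω 0)) y (hf.comp (measurable_pi_apply 0)),
      lintegral_stepLaw _ hf, Finset.sum_eq_single y]
    · simp only [prepend, lintegral_const, measure_univ, mul_one, PMF.pure_apply, if_true, one_mul,
        ← Finset.sum_mul, sum_nextPair]
    · intro b _ hb
      simp [PMF.pure_apply, hb]
    · simp
  · refine Measure.ext_of_lintegral _ fun f hf => ?_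
    rw [Measure.lintegral_compProd hf,
      lintegral_map hf.lintegral_kernel_prod_right' (Preorder.measurable_frestrictLe n),
      lintegral_map hf (by fun_prop)]
    exact (lintegral_restartLaw_succ y n hf).symm

/-! ### The return distributions and the distributional Bellman equation -/

theorem ae_restartLaw {y : M.Pair} {p : (ℕ → M.Step) → Prop} (hp : MeasurableSet {ω | p ω})
    (h : ∀ y' : M.Pair, ∀ᵐ r ∂(M.reward y.1 y.2 : Measure ℝ), ∀ᵐ ω ∂M.trajLaw π y'.1 y'.2,
      p (prepend (y, r) ω)) : ∀ᵐ ω ∂M.restartLaw π y, p ω := by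
  rw [ae_iff, ← Set.compl_ofPred, ← lintegral_indicator_one hp.compl,
    lintegral_restartLaw y (measurable_one.indicator hp.compl)]
  refine Finset.sum_eq_zero fun y' _ => ?_
  rw [lintegral_congr_ae (g := fun _ => 0), lintegral_zero, mul_zero]
  filter_upwards [h y'] with r hr
  rw [lintegral_congr_ae (g := fun _ => 0), lintegral_zero]
  filter_upwards [hr] with ω hω
  exact Set.indicator_of_notMem (s := {ω | p ω}ᶜ) (Set.notMem_compl_iff.2 hω) _

theorem ae_reward_mem {R : ℝ} (hR : ∀ x a, (M.reward x a : Measure ℝ) (Set.Icc (-R) R) = 1)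
    (y : M.Pair) : ∀ᵐ ω ∂M.trajLaw π y.1 y.2, ∀ t, (ω t).2 ∈ Set.Icc (-R) R := by
  rw [ae_all_iff]
  intro t
  induction t generalizing y with
  | zero =>
    rw [trajLaw_eq_restartLaw]
    refine ae_restartLaw (measurableSet_Icc.preimage (by fun_prop)) fun y' => ?_
    filter_upwards [(mem_ae_iff_prob_eq_one measurableSet_Icc).2 (hR y.1 y.2)] with r hr
    exact ae_of_all _ fun ω => hr
  | succ t ih =>
    rw [trajLaw_eq_restartLaw]
    refine ae_restartLaw (measurableSet_Icc.preimage (by fun_prop)) fun y' => ?_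
    exact ae_of_all _ fun r => ih y'

section Return

variable {R : ℝ} {ω : ℕ → M.Step}

theorem hasSum_pow_mul_const (M : MDP.{u, v}) (R : ℝ) :
    HasSum (fun t : ℕ => M.γ ^ t * R) (R / (1 - M.γ)) := by
  rw [div_eq_inv_mul]
  exact (hasSum_geometric_of_lt_one M.γ_nonneg M.γ_lt_one).mul_right R

theorem norm_pow_mul_reward_le (h : ∀ t, (ω t).2 ∈ Set.Icc (-R) R) (t : ℕ) :
    ‖M.γ ^ t * (ω t).2‖ ≤ M.γ ^ t * R := by
  rw [norm_mul, Real.norm_of_nonneg (pow_nonneg M.γ_nonneg t)]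
  exact mul_le_mul_of_nonneg_left (abs_le.2 (h t)) (pow_nonneg M.γ_nonneg t)

theorem abs_discountedReturn_le (h : ∀ t, (ω t).2 ∈ Set.Icc (-R) R) :
    |M.discountedReturn ω| ≤ R / (1 - M.γ) :=
  tsum_of_norm_bounded (M.hasSum_pow_mul_const R) (norm_pow_mul_reward_le h)

/-- The return is the first reward plus `γ` times the return of the remaining trajectory. Bounded
rewards are needed: without summability `tsum` is `0` and the recursion may fail. -/
theorem discountedReturn_prepend (w : M.Step) (h : ∀ t, (ω t).2 ∈ Set.Icc (-R) R) :
    M.discountedReturn (prepend w ω) = w.2 + M.γ * M.discountedReturn ω := by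
  have hs : Summable fun t => M.γ ^ t * (ω t).2 :=
    Summable.of_norm_bounded (M.hasSum_pow_mul_const R).summable (norm_pow_mul_reward_le h)
  have hs' : ∀ t, M.γ ^ (t + 1) * (prepend w ω (t + 1)).2 = M.γ * (M.γ ^ t * (ω t).2) :=
    fun t => by simp only [prepend]; ring
  have hsum : Summable fun t => M.γ ^ t * (prepend w ω t).2 :=
    (summable_nat_add_iff 1).1 (by simpa only [hs'] using hs.mul_left M.γ)
  rw [discountedReturn, hsum.tsum_eq_zero_add]
  simp only [hs', tsum_mul_left, pow_zero, one_mul]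
  rfl

end Return

/-- The return distributions are supported on `[-R / (1 - γ), R / (1 - γ)]`. -/
theorem ae_returnDist_mem {R : ℝ}
    (hR : ∀ x a, (M.reward x a : Measure ℝ) (Set.Icc (-R) R) = 1) (x : M.State) (a : M.Action) :
    ∀ᵐ z ∂(M.returnDist π x a : Measure ℝ), |z| ≤ R / (1 - M.γ) := by
  change ∀ᵐ z ∂(M.trajLaw π x a).map M.discountedReturn, _
  rw [ae_map_iff M.measurable_discountedReturn.aemeasurable
    (measurableSet_le (by fun_prop) measurable_const)]
  filter_upwards [ae_reward_mem hR (x, a)] with ω hω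
  exact abs_discountedReturn_le hω

theorem lintegral_bellman (η : M.State → M.Action → ProbabilityMeasure ℝ) (x : M.State)
    (a : M.Action) {f : ℝ → ℝ≥0∞} (hf : Measurable f) :
    ∫⁻ z, f z ∂(M.bellman π η x a : Measure ℝ) = ∑ y, M.nextPair π (x, a) y *
      ∫⁻ r, ∫⁻ z, f (r + M.γ * z) ∂(η y.1 y.2 : Measure ℝ) ∂(M.reward x a : Measure ℝ) := by
  rw [bellman, ProbabilityMeasure.coe_mk, lintegral_finsetSum_measure]
  refine Finset.sum_congr rfl fun y _ => ?_
  have hm : Measurable fun p : ℝ × ℝ => p.1 + M.γ * p.2 := by fun_prop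
  rw [lintegral_smul_measure, lintegral_map hf hm, smul_eq_mul,
    lintegral_prod (fun p : ℝ × ℝ => f (p.1 + M.γ * p.2)) (hf.comp hm).aemeasurable]

/-- The distributional Bellman equation `η^π = 𝒯^π η^π`. -/
theorem bellman_returnDist {R : ℝ}
    (hR : ∀ x a, (M.reward x a : Measure ℝ) (Set.Icc (-R) R) = 1) :
    M.bellman π (M.returnDist π) = M.returnDist π := by
  funext x a
  refine Subtype.ext (Measure.ext_of_lintegral _ fun f hf => ?_)
  have hG := M.measurable_discountedReturn
  have hL : ∀ x a (g : ℝ → ℝ≥0∞), Measurable g → ∫⁻ z, g z ∂(M.returnDist π x a : Measure ℝ)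
      = ∫⁻ ω, g (M.discountedReturn ω) ∂M.trajLaw π x a := fun x a g hg => lintegral_map hg hG
  refine (lintegral_bellman _ x a hf).trans ?_
  refine Eq.trans ?_ (hL x a f hf).symm
  rw [show M.trajLaw π x a = M.restartLaw π (x, a) from trajLaw_eq_restartLaw (x, a),
    lintegral_restartLaw (f := fun ω => f (M.discountedReturn ω)) _ (hf.comp hG)]
  refine Finset.sum_congr rfl fun y _ => ?_
  congr 1
  refine lintegral_congr fun r => ?_
  rw [hL y.1 y.2 (fun z => f (r + M.γ * z)) (hf.comp (by fun_prop))]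
  refine lintegral_congr_ae ?_
  filter_upwards [ae_reward_mem hR y] with ω hω
  rw [discountedReturn_prepend _ hω]

theorem integral_bellman (η : M.State → M.Action → ProbabilityMeasure ℝ) (x : M.State)
    (a : M.Action) {f : ℝ → ℝ} (hf : Continuous f) {C : ℝ} (hC : ∀ z, |f z| ≤ C) :
    ∫ z, f z ∂(M.bellman π η x a : Measure ℝ) = ∑ y, (M.nextPair π (x, a) y).toReal *
      ∫ z, (∫ r, f (r + M.γ * z) ∂(M.reward x a : Measure ℝ)) ∂(η y.1 y.2 : Measure ℝ) := by
  have hm : Measurable fun p : ℝ × ℝ => p.1 + M.γ * p.2 := by fun_prop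
  have hint : ∀ (μ : Measure ℝ) [IsProbabilityMeasure μ], Integrable f μ := fun μ _ =>
    Integrable.of_bound hf.aestronglyMeasurable C (ae_of_all _ hC)
  have hint2 : ∀ y : M.Pair, Integrable (fun p : ℝ × ℝ => f (p.1 + M.γ * p.2))
      ((M.reward x a : Measure ℝ).prod (η y.1 y.2 : Measure ℝ)) := fun y =>
    Integrable.of_bound (hf.comp (by fun_prop)).aestronglyMeasurable C (ae_of_all _ fun _ => hC _)
  rw [bellman, ProbabilityMeasure.coe_mk, integral_finsetSum_measure]
  · refine Finset.sum_congr rfl fun y _ => ?_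
    rw [integral_smul_measure, integral_map hm.aemeasurable hf.aestronglyMeasurable,
      integral_prod_symm _ (hint2 y), smul_eq_mul]
  · intro y _
    have := Measure.isProbabilityMeasure_map
      (μ := (M.reward x a : Measure ℝ).prod (η y.1 y.2 : Measure ℝ)) hm.aemeasurable
    exact (hint _).smul_measure (PMF.apply_ne_top _ _)

end MDP

/-! ### The categorical statistics on an evenly spaced grid -/

theorem abs_integral_le_of_ae {μ : Measure ℝ} [IsProbabilityMeasure μ] {f : ℝ → ℝ} {C : ℝ}
    (h : ∀ᵐ x ∂μ, |f x| ≤ C) : |∫ x, f x ∂μ| ≤ C :=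
  (norm_integral_le_of_norm_le_const (f := f) h).trans_eq (by rw [probReal_univ, mul_one])

theorem integral_sum_smul_dirac {ι : Type*} [Fintype ι] {p : ι → ℝ} (hp : ∀ j, 0 ≤ p j)
    (z : ι → ℝ) (g : ℝ → ℝ) :
    ∫ x, g x ∂(∑ j, ENNReal.ofReal (p j) • Measure.dirac (z j)) = ∑ j, p j * g (z j) := by
  rw [integral_finsetSum_measure fun j _ =>
    (integrable_dirac (by simp [enorm_lt_top])).smul_measure ENNReal.ofReal_ne_top]
  simp only [integral_smul_measure, integral_dirac, ENNReal.toReal_ofReal (hp _), smul_eq_mul]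

theorem sum_by_parts (c f : ℕ → ℝ) (n : ℕ) :
    ∑ j ∈ Finset.range (n + 1), (c (j + 1) - c j) * f j
      = c (n + 1) * f n - c 0 * f 0 + ∑ j ∈ Finset.range n, c (j + 1) * (f j - f (j + 1)) := by
  induction n with
  | zero => simp; ring
  | succ n ih => rw [Finset.sum_range_succ, ih, Finset.sum_range_succ]; ring

section Grid

variable {K : ℕ} {z : Fin K → ℝ} {c Δ : ℝ}

theorem cdrlStat_eq (hgrid : ∀ k : Fin K, z k = gridPoint c Δ k) (k : Fin (K - 1))
    (μ : ProbabilityMeasure ℝ) :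
    cdrlStat z k μ = ∫ x, gridRamp c Δ k x ∂(μ : Measure ℝ) := by
  simp only [cdrlStat, hgrid, gridRamp]

theorem integral_cdrlImputation (hK : 2 ≤ K) (hz : StrictMono z)
    (hgrid : ∀ k : Fin K, z k = gridPoint c Δ k) (σ : attainable (cdrlStat z)) (g : ℝ → ℝ) :
    ∫ x, g x ∂((cdrlImputation hK z hz).impute σ : Measure ℝ)
      = g (gridPoint c Δ (K - 1)) + ∑ k : Fin (K - 1), (σ : Fin (K - 1) → ℝ) k *
        (g (gridPoint c Δ k) - g (gridPoint c Δ (k + 1))) := by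
  change ∫ x, g x ∂cdrlMeasure z (σ : Fin (K - 1) → ℝ) = _
  rw [cdrlMeasure, integral_sum_smul_dirac (cdrlProb_nonneg hz σ)]
  simp only [hgrid]
  rw [sum_cdrlProb _ fun j => g (gridPoint c Δ j)]
  obtain ⟨n, rfl⟩ : ∃ n, K = n + 1 := ⟨K - 1, by omega⟩
  rw [sum_by_parts _ fun j => g (gridPoint c Δ j)]
  simp only [Nat.add_sub_cancel]
  rw [Finset.sum_range]
  simp [cdrlCum]

/-- Interpolating `g` and integrating against `μ` has the same value as integrating `g` against the
distribution imputed from the statistics of `μ`; compare `integral_cdrlImputation`. -/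
theorem integral_gridInterp (hgrid : ∀ k : Fin K, z k = gridPoint c Δ k)
    (μ : ProbabilityMeasure ℝ) (g : ℝ → ℝ) :
    ∫ x, gridInterp c Δ (K - 1) g x ∂(μ : Measure ℝ)
      = g (gridPoint c Δ (K - 1)) + ∑ k : Fin (K - 1), cdrlStat z k μ *
        (g (gridPoint c Δ k) - g (gridPoint c Δ (k + 1))) := by
  have hi : ∀ k, Integrable (gridRamp c Δ k) (μ : Measure ℝ) := fun k => integrable_ramp _ _ μ
  simp only [gridInterp]
  rw [integral_add (integrable_const _) (integrable_finsetSum _ fun k _ => (hi k).mul_const _),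
    integral_finsetSum _ fun k _ => (hi k).mul_const _, Finset.sum_range]
  simp only [integral_const, probReal_univ, one_smul, integral_mul_const, cdrlStat_eq hgrid]

/-- Imputing from the statistics of a distribution supported on the grid's range changes the
integral of an `L`-Lipschitz function by at most `L Δ / 2`. -/
theorem abs_integral_sub_integral_impute_le (hK : 2 ≤ K) (hz : StrictMono z) (hΔ : 0 < Δ)
    (hgrid : ∀ k : Fin K, z k = gridPoint c Δ k) {μ : ProbabilityMeasure ℝ}
    (hμ : ∀ᵐ x ∂(μ : Measure ℝ), x ∈ Set.Icc (gridPoint c Δ 0) (gridPoint c Δ (K - 1)))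
    {g : ℝ → ℝ} {L : ℝ} (hg : ∀ x y, |g x - g y| ≤ L * |x - y|)
    (hint : Integrable g (μ : Measure ℝ)) :
    |∫ x, g x ∂(μ : Measure ℝ) - ∫ x, g x ∂((cdrlImputation hK z hz).impute
      ⟨fun k => cdrlStat z k μ, Set.mem_range_self μ⟩ : Measure ℝ)| ≤ L * Δ / 2 := by
  have hi : Integrable (gridInterp c Δ (K - 1) g) (μ : Measure ℝ) :=
    (integrable_const _).add (integrable_finsetSum _ fun k _ =>
      (integrable_ramp _ _ μ).mul_const _)
  rw [integral_cdrlImputation hK hz hgrid, ← integral_gridInterp hgrid, ← integral_sub hint hi]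
  refine abs_integral_le_of_ae ?_
  filter_upwards [hμ] with x hx
  exact abs_sub_gridInterp_le hΔ hg (K - 1) hx.1 hx.2

/-- The integrals of an `L`-Lipschitz function against two imputed distributions differ by at most
`L Δ` times the `ℓ¹` distance of the statistics: Kantorovich duality on the grid. -/
theorem abs_integral_impute_sub_le (hK : 2 ≤ K) (hz : StrictMono z) (hΔ : 0 < Δ)
    (hgrid : ∀ k : Fin K, z k = gridPoint c Δ k) (σ τ : attainable (cdrlStat z))
    {g : ℝ → ℝ} {L : ℝ} (hg : ∀ x y, |g x - g y| ≤ L * |x - y|) :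
    |∫ x, g x ∂((cdrlImputation hK z hz).impute σ : Measure ℝ)
        - ∫ x, g x ∂((cdrlImputation hK z hz).impute τ : Measure ℝ)|
      ≤ L * Δ * ∑ k, |(σ : Fin (K - 1) → ℝ) k - (τ : Fin (K - 1) → ℝ) k| := by
  rw [integral_cdrlImputation hK hz hgrid, integral_cdrlImputation hK hz hgrid,
    add_sub_add_left_eq_sub, ← Finset.sum_sub_distrib, Finset.mul_sum]
  refine (Finset.abs_sum_le_sum_abs _ _).trans (Finset.sum_le_sum fun k _ => ?_)
  rw [← sub_mul, abs_mul, mul_comm]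
  refine mul_le_mul_of_nonneg_right ((hg _ _).trans_eq ?_) (abs_nonneg _)
  rw [gridPoint_succ, sub_add_cancel_left, abs_neg, abs_of_pos hΔ]

/-- If `η` and `η'` assign nearby integrals to all bounded `γ / Δ`-Lipschitz functions, then their
images under the Bellman operator have nearby statistics: a signed sum of the ramps is
`1 / Δ`-Lipschitz, and averaging it over `r + γ z` multiplies the Lipschitz constant by `γ`. -/
theorem sum_abs_cdrlStat_bellman_sub_le (hΔ : 0 < Δ)
    (hgrid : ∀ k : Fin K, z k = gridPoint c Δ k) {M : MDP.{u, v}} {π : M.Policy}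
    {η η' : M.State → M.Action → ProbabilityMeasure ℝ} {B : ℝ}
    (hB : ∀ g : ℝ → ℝ, (∀ x y, |g x - g y| ≤ M.γ / Δ * |x - y|) → (∃ C, ∀ x, |g x| ≤ C) →
      ∀ x a, |∫ w, g w ∂(η x a : Measure ℝ) - ∫ w, g w ∂(η' x a : Measure ℝ)| ≤ B)
    (x : M.State) (a : M.Action) :
    ∑ k, |cdrlStat z k (M.bellman π η x a) - cdrlStat z k (M.bellman π η' x a)| ≤ B := by
  let d : Fin (K - 1) → ℝ := fun k =>
    cdrlStat z k (M.bellman π η x a) - cdrlStat z k (M.bellman π η' x a)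
  -- The signs `ε k` turn the sum of absolute values into the difference of the integrals of `f`.
  set ε : Fin (K - 1) → ℝ := fun k => if 0 ≤ d k then 1 else -1 with hε
  have hεabs : ∀ k, |ε k| = 1 := fun k => by
    simp only [hε]; split_ifs <;> simp
  have hεd : ∀ k, |d k| = ε k * d k := fun k => by
    simp only [hε]
    split_ifs with h
    · rw [abs_of_nonneg h, one_mul]
    · rw [abs_of_neg (not_le.1 h), neg_one_mul]
  let f : ℝ → ℝ := fun w => ∑ k, ε k * gridRamp c Δ k w
  have hfL : ∀ u v, |f u - f v| ≤ |u - v| / Δ := fun u v => by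
    refine le_trans ?_ (sum_abs_gridRamp_sub_le c hΔ (K - 1) u v)
    rw [Finset.sum_range]
    simp only [f, ← Finset.sum_sub_distrib, ← mul_sub]
    refine (Finset.abs_sum_le_sum_abs _ _).trans_eq (Finset.sum_congr rfl fun k _ => ?_)
    rw [abs_mul, hεabs, one_mul]
  have hfC : ∀ u, |f u| ≤ (K - 1 : ℕ) := fun u => by
    refine (Finset.abs_sum_le_sum_abs _ _).trans ?_
    refine (Finset.sum_le_card_nsmul _ _ 1 fun k _ => ?_).trans_eq (by simp)
    rw [abs_mul, hεabs, one_mul, gridRamp, abs_of_nonneg (ramp_nonneg _ _ _)]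
    exact ramp_le_one _ _ _
  have hfc : Continuous f := by
    refine (LipschitzWith.of_dist_le_mul (K := (1 / Δ).toNNReal) fun u v => ?_).continuous
    rw [Real.dist_eq, Real.dist_eq, Real.coe_toNNReal _ (by positivity), one_div_mul_eq_div]
    exact hfL u v
  have hstat : ∀ μ : ProbabilityMeasure ℝ,
      ∑ k, ε k * cdrlStat z k μ = ∫ w, f w ∂(μ : Measure ℝ) := fun μ => by
    have hi : ∀ k : Fin (K - 1), Integrable (fun w => ε k * gridRamp c Δ k w) (μ : Measure ℝ) :=
      fun k => (integrable_ramp _ _ μ).const_mul _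
    rw [integral_finsetSum _ fun k _ => hi k]
    simp only [integral_const_mul, cdrlStat_eq hgrid]
  let g : ℝ → ℝ := fun w => ∫ r, f (r + M.γ * w) ∂(M.reward x a : Measure ℝ)
  have hfi : ∀ w, Integrable (fun r => f (r + M.γ * w)) (M.reward x a : Measure ℝ) := fun w =>
    Integrable.of_bound (hfc.comp (by fun_prop)).aestronglyMeasurable _
      (ae_of_all _ fun r => hfC _)
  have hgL : ∀ u v, |g u - g v| ≤ M.γ / Δ * |u - v| := fun u v => by
    simp only [g]
    rw [← integral_sub (hfi u) (hfi v)]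
    refine abs_integral_le_of_ae (ae_of_all _ fun r => ?_)
    refine (hfL _ _).trans_eq ?_
    rw [add_sub_add_left_eq_sub, ← mul_sub, abs_mul, abs_of_nonneg M.γ_nonneg]
    ring
  have hgC : ∃ C, ∀ u, |g u| ≤ C := ⟨(K - 1 : ℕ), fun u =>
    abs_integral_le_of_ae (ae_of_all _ fun r => hfC _)⟩
  have hsum : ∑ y, (M.nextPair π (x, a) y).toReal = 1 := by
    rw [← ENNReal.toReal_sum fun y _ => PMF.apply_ne_top _ _, MDP.sum_nextPair, ENNReal.toReal_one]
  calc ∑ k, |d k| = ∑ k, ε k * d k := Finset.sum_congr rfl fun k _ => hεd k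
    _ = ∫ w, f w ∂(M.bellman π η x a : Measure ℝ)
        - ∫ w, f w ∂(M.bellman π η' x a : Measure ℝ) := by
      rw [← hstat, ← hstat, ← Finset.sum_sub_distrib]
      exact Finset.sum_congr rfl fun k _ => mul_sub _ _ _
    _ = ∑ y, (M.nextPair π (x, a) y).toReal * (∫ w, g w ∂(η y.1 y.2 : Measure ℝ)
        - ∫ w, g w ∂(η' y.1 y.2 : Measure ℝ)) := by
      rw [MDP.integral_bellman η x a hfc hfC, MDP.integral_bellman η' x a hfc hfC,
        ← Finset.sum_sub_distrib]
      exact Finset.sum_congr rfl fun y _ => (mul_sub _ _ _).symm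
    _ ≤ ∑ y, (M.nextPair π (x, a) y).toReal * B :=
      Finset.sum_le_sum fun y _ => mul_le_mul_of_nonneg_left
        ((le_abs_self _).trans (hB g hgL hgC y.1 y.2)) ENNReal.toReal_nonneg
    _ = B := by rw [← Finset.sum_mul, hsum, one_mul]

/-- The update is a `γ`-contraction for the largest `ℓ¹` distance over state-action pairs. -/
theorem sum_abs_update_sub_le (hK : 2 ≤ K) (hz : StrictMono z) (hΔ : 0 < Δ)
    (hgrid : ∀ k : Fin K, z k = gridPoint c Δ k) {M : MDP.{u, v}} {π : M.Policy}
    {σ τ : Estimates M (cdrlStat z)} {B : ℝ}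
    (hB : ∀ x a, ∑ k, |(σ x a : Fin (K - 1) → ℝ) k - (τ x a : Fin (K - 1) → ℝ) k| ≤ B)
    (x : M.State) (a : M.Action) :
    ∑ k, |(update M π _ (cdrlImputation hK z hz) σ x a : Fin (K - 1) → ℝ) k
      - (update M π _ (cdrlImputation hK z hz) τ x a : Fin (K - 1) → ℝ) k| ≤ M.γ * B := by
  refine sum_abs_cdrlStat_bellman_sub_le hΔ hgrid (fun g hg _ x a => ?_) x a
  refine (abs_integral_impute_sub_le hK hz hΔ hgrid (σ x a) (τ x a) hg).trans ?_
  rw [div_mul_cancel₀ _ hΔ.ne']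
  exact mul_le_mul_of_nonneg_left (hB x a) M.γ_nonneg

/-- If `σ` is a fixed point of the update, then the one-step error `γ / 2` of imputing from the
exact statistics accumulates to at most `γ / 2 + γ² / 2 + ⋯ = γ / (2 (1 - γ))`. -/
theorem sum_abs_returnDist_sub_le (hK : 2 ≤ K) (hz : StrictMono z) (hΔ : 0 < Δ)
    (hgrid : ∀ k : Fin K, z k = gridPoint c Δ k) {M : MDP.{u, v}} {π : M.Policy} {R : ℝ}
    (hR : ∀ x a, (M.reward x a : Measure ℝ) (Set.Icc (-R) R) = 1)
    (hc : gridPoint c Δ 0 = -(R / (1 - M.γ))) (hc' : gridPoint c Δ (K - 1) = R / (1 - M.γ))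
    {σ : Estimates M (cdrlStat z)} (hσ : update M π _ (cdrlImputation hK z hz) σ = σ)
    (x : M.State) (a : M.Action) :
    ∑ k, |cdrlStat z k (M.returnDist π x a) - (σ x a : Fin (K - 1) → ℝ) k|
      ≤ M.γ / (2 * (1 - M.γ)) := by
  let D : M.Pair → ℝ := fun y =>
    ∑ k, |cdrlStat z k (M.returnDist π y.1 y.2) - (σ y.1 y.2 : Fin (K - 1) → ℝ) k|
  have : Nonempty M.Pair := ⟨(x, a)⟩
  obtain ⟨y₀, hy₀⟩ := Finite.exists_max D
  have hstep : ∀ x a, D (x, a) ≤ M.γ / 2 + M.γ * D y₀ := by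
    intro x a
    have hb := sum_abs_cdrlStat_bellman_sub_le (π := π) (η := M.returnDist π)
      (η' := fun x a => (cdrlImputation hK z hz).impute (σ x a)) (B := M.γ / 2 + M.γ * D y₀)
      hΔ hgrid (fun g hg hgC x a => ?_) x a
    · rw [MDP.bellman_returnDist hR] at hb
      have hk : ∀ k, cdrlStat z k (M.bellman π
          (fun x a => (cdrlImputation hK z hz).impute (σ x a)) x a)
          = (σ x a : Fin (K - 1) → ℝ) k := fun k =>
        congrArg (fun τ : Estimates M (cdrlStat z) => (τ x a : Fin (K - 1) → ℝ) k) hσ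
      simp only [hk] at hb
      exact hb
    · obtain ⟨C, hC⟩ := hgC
      have hgc : Continuous g := by
        refine (LipschitzWith.of_dist_le_mul (K := (M.γ / Δ).toNNReal) fun u v => ?_).continuous
        rw [Real.dist_eq, Real.dist_eq,
          Real.coe_toNNReal _ (div_nonneg M.γ_nonneg hΔ.le)]
        exact hg u v
      have h1 := abs_integral_sub_integral_impute_le hK hz hΔ hgrid
        (μ := M.returnDist π x a) ?_ hg
        (Integrable.of_bound hgc.aestronglyMeasurable C (ae_of_all _ hC))
      · have h2 := abs_integral_impute_sub_le hK hz hΔ hgrid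
          ⟨fun k => cdrlStat z k (M.returnDist π x a), Set.mem_range_self _⟩ (σ x a) hg
        rw [div_mul_cancel₀ _ hΔ.ne'] at h1 h2
        exact (abs_sub_le _ _ _).trans (add_le_add h1
          (h2.trans (mul_le_mul_of_nonneg_left (hy₀ (x, a)) M.γ_nonneg)))
      · filter_upwards [MDP.ae_returnDist_mem hR x a] with w hw
        rw [hc, hc']
        exact abs_le.1 hw
  have h0 := hstep y₀.1 y₀.2
  have hγ := M.γ_lt_one
  refine (hy₀ (x, a)).trans ?_
  rw [le_div_iff₀ (by linarith)]
  change D y₀ ≤ _ at h0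
  linarith

end Grid

/-! ### Existence of the learnt values -/

/-- The attainable values are the linear image of the simplex of probability vectors on the bin
locations, because imputation realizes every attainable vector by such a distribution. -/
theorem isClosed_attainable_cdrlStat {K : ℕ} (hK : 2 ≤ K) {z : Fin K → ℝ} (hz : StrictMono z) :
    IsClosed (attainable (cdrlStat z)) := by
  let T : (Fin K → ℝ) → Fin (K - 1) → ℝ := fun p k =>
    ∑ j, p j * ramp (z ⟨k, by omega⟩) (z ⟨k + 1, by omega⟩) (z j)
  have himage : attainable (cdrlStat z) = T '' stdSimplex ℝ (Fin K) := by
    apply Set.Subset.antisymm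
    · intro σ hσ
      refine ⟨cdrlProb σ, ⟨cdrlProb_nonneg hz ⟨σ, hσ⟩, ?_⟩, ?_⟩
      · have h := isProbabilityMeasure_cdrlMeasure hK hz ⟨σ, hσ⟩
        have h1 := integral_sum_smul_dirac (cdrlProb_nonneg hz ⟨σ, hσ⟩) z fun _ => 1
        change ∫ _, (1 : ℝ) ∂cdrlMeasure z σ = _ at h1
        simpa using h1.symm
      · funext k
        exact (integral_sum_smul_dirac (cdrlProb_nonneg hz ⟨σ, hσ⟩) z _).symm.trans
          (cdrlStat_cdrlMeasure hK hz ⟨σ, hσ⟩ k)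
    · rintro _ ⟨p, ⟨hp, hp1⟩, rfl⟩
      refine ⟨⟨∑ j, ENNReal.ofReal (p j) • Measure.dirac (z j), ⟨?_⟩⟩, ?_⟩
      · simp only [Measure.coe_finsetSum, Finset.sum_apply, Measure.smul_apply, measure_univ,
          smul_eq_mul, mul_one]
        rw [← ENNReal.ofReal_sum_of_nonneg fun j _ => hp j, hp1, ENNReal.ofReal_one]
      · funext k
        exact integral_sum_smul_dirac hp z _
  rw [himage]
  exact ((isCompact_stdSimplex ℝ (Fin K)).image (by fun_prop)).isClosed

section FixedPoint

variable {M : MDP.{u, v}} {π : M.Policy} {N : ℕ} {s : Fin N → Statistic}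

theorem dist_estimates_le {σ τ : Estimates M s} {B : ℝ} (hB0 : 0 ≤ B)
    (hB : ∀ x a, ∑ k, |(σ x a : Fin N → ℝ) k - (τ x a : Fin N → ℝ) k| ≤ B) : dist σ τ ≤ B := by
  refine (dist_pi_le_iff hB0).2 fun x => (dist_pi_le_iff hB0).2 fun a => ?_
  rw [Subtype.dist_eq]
  refine (dist_pi_le_iff hB0).2 fun k => le_trans ?_ (hB x a)
  exact Finset.single_le_sum
    (f := fun k => |(σ x a : Fin N → ℝ) k - (τ x a : Fin N → ℝ) k|)
    (fun k _ => abs_nonneg _) (Finset.mem_univ k)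

theorem sum_abs_sub_le_dist (σ τ : Estimates M s) (x : M.State) (a : M.Action) :
    ∑ k, |(σ x a : Fin N → ℝ) k - (τ x a : Fin N → ℝ) k| ≤ N * dist σ τ := by
  refine (Finset.sum_le_card_nsmul _ _ (dist σ τ) fun k _ => ?_).trans_eq (by simp)
  have h1 : dist (σ x a : Fin N → ℝ) (τ x a) ≤ dist σ τ :=
    (dist_le_pi_dist (σ x) (τ x) a).trans (dist_le_pi_dist σ τ x)
  exact (dist_le_pi_dist (σ x a : Fin N → ℝ) (τ x a) k).trans h1

/-- The Banach fixed point theorem for the largest `ℓ¹` distance over state-action pairs. -/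
theorem exists_isLearnt {Ψ : ImputationStrategy s} (hcl : IsClosed (attainable s))
    (hcontr : ∀ (σ τ : Estimates M s) (B : ℝ),
      (∀ x a, ∑ k, |(σ x a : Fin N → ℝ) k - (τ x a : Fin N → ℝ) k| ≤ B) →
      ∀ x a, ∑ k, |(update M π s Ψ σ x a : Fin N → ℝ) k - (update M π s Ψ τ x a : Fin N → ℝ) k|
        ≤ M.γ * B) :
    ∃ σ : Estimates M s, IsLearnt M π s Ψ σ := by
  have hdist : ∀ σ τ : Estimates M s, 0 ≤ N * dist σ τ := fun σ τ => by positivity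
  have hiter : ∀ (σ τ : Estimates M s) (n : ℕ),
      dist ((update M π s Ψ)^[n] σ) ((update M π s Ψ)^[n] τ) ≤ N * dist σ τ * M.γ ^ n := by
    intro σ τ n
    refine dist_estimates_le (mul_nonneg (hdist σ τ) (pow_nonneg M.γ_nonneg n)) ?_
    induction n with
    | zero => simpa using sum_abs_sub_le_dist σ τ
    | succ n ih =>
      rw [Function.iterate_succ_apply', Function.iterate_succ_apply', pow_succ', mul_left_comm]
      exact hcontr _ _ _ ih
  have hgeom : ∀ C : ℝ, Tendsto (fun n : ℕ => C * M.γ ^ n) atTop (𝓝 0) := fun C => by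
    simpa using (tendsto_pow_atTop_nhds_zero_of_lt_one M.γ_nonneg M.γ_lt_one).const_mul C
  have hne : Nonempty (attainable s) :=
    ⟨⟨_, Set.mem_range_self (⟨Measure.dirac 0, inferInstance⟩ : ProbabilityMeasure ℝ)⟩⟩
  have : CompleteSpace (attainable s) := hcl.completeSpace_coe
  obtain ⟨σ₀⟩ : Nonempty (Estimates M s) := inferInstance
  obtain ⟨σ, hσ⟩ := cauchySeq_tendsto_of_complete
    (cauchySeq_of_le_geometric (f := fun n => (update M π s Ψ)^[n] σ₀) M.γ
      (N * dist σ₀ (update M π s Ψ σ₀)) M.γ_lt_one fun n => by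
        simpa only [← Function.iterate_succ_apply] using hiter σ₀ (update M π s Ψ σ₀) n)
  have hfix : update M π s Ψ σ = σ := by
    refine tendsto_nhds_unique (tendsto_iff_dist_tendsto_zero.2 ?_)
      (hσ.comp (tendsto_add_atTop_nat 1))
    refine squeeze_zero (fun _ => dist_nonneg) (fun n => ?_)
      (g := fun n => N * dist ((update M π s Ψ)^[n] σ₀) σ * M.γ) ?_
    · have h := hiter ((update M π s Ψ)^[n] σ₀) σ 1
      rw [pow_one] at h
      simpa only [Function.comp_apply, Function.iterate_succ_apply', Function.iterate_zero, id]
        using h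
    · simpa using ((tendsto_iff_dist_tendsto_zero.1 hσ).const_mul (N : ℝ)).mul_const M.γ
  refine ⟨σ, hfix, fun τ => tendsto_iff_dist_tendsto_zero.2 ?_⟩
  refine squeeze_zero (fun _ => dist_nonneg) (fun n => ?_) (hgeom (N * dist τ σ))
  simpa only [Function.iterate_fixed hfix] using hiter τ σ n

end FixedPoint

end DistRL

/-- CDRL with `K ≥ 2` evenly spaced bin locations
`-Rmax / (1 - γ) = z_1 < ⋯ < z_K = Rmax / (1 - γ)` is `γ / (2 (1 - γ) (K - 1))`-approximately
Bellman closed for the class of MDPs with discount rate `γ` and rewards in `[-Rmax, Rmax]`. -/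
theorem theorem2 (γ Rmax : ℝ) (hγ0 : 0 ≤ γ) (hγ1 : γ < 1) (hR : 0 < Rmax)
    (K : ℕ) (hK : 2 ≤ K) (z : Fin K → ℝ) (hz : StrictMono z)
    (hspacing : ∀ k : Fin K, z k =
      -(Rmax / (1 - γ)) + (k : ℝ) * ((2 * (Rmax / (1 - γ))) / ((K : ℝ) - 1))) :
    DistRL.ApproxBellmanClosed (DistRL.boundedRewardMDPs.{u, v} γ Rmax)
      (DistRL.cdrlStat z) (DistRL.cdrlImputation hK z hz)
      (γ / (2 * (1 - γ) * ((K : ℝ) - 1))) := by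
  rintro M ⟨rfl, hM⟩ π
  have hK1 : (0 : ℝ) < (K : ℝ) - 1 := by
    have : (2 : ℝ) ≤ K := by exact_mod_cast hK
    linarith
  have hcast : ((K - 1 : ℕ) : ℝ) = (K : ℝ) - 1 := by
    rw [Nat.cast_sub (by omega), Nat.cast_one]
  have h1γ : 0 < 1 - M.γ := sub_pos.2 hγ1
  have hΔ : 0 < 2 * (Rmax / (1 - M.γ)) / ((K : ℝ) - 1) := by positivity
  obtain ⟨σ, hσ⟩ := DistRL.exists_isLearnt (M := M) (π := π)
    (DistRL.isClosed_attainable_cdrlStat hK hz)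
    fun σ τ B hB => DistRL.sum_abs_update_sub_le hK hz hΔ hspacing hB
  refine ⟨σ, hσ, fun x a => ?_⟩
  have h := DistRL.sum_abs_returnDist_sub_le hK hz hΔ hspacing hM (by simp [DistRL.gridPoint])
    (by rw [DistRL.gridPoint, hcast]; field_simp; ring) hσ.1 x a
  rw [hcast, one_div_mul_eq_div, ← div_div]
  exact div_le_div_of_nonneg_right h hK1.le
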